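/- **Lower Dimension Criterion for Admissibility.** Let $\Phi$ be a self-similar system, i.e. a nonempty finite set of maps $\varphi:X\to X$ of a complete metric space $(X,d)$ (with at least two points) such that $d(\varphi(x),\varphi(y))=\lambda_\varphi\,d(x,y)$ for all $x,y\in X$, with scaling ratio $\lambda_\varphi\in(0,1)$. Let $r_1>\dots>r_M$ be the distinct scaling ratios of $\Phi$, with multiplicities $m_1,\dots,m_M$, and let the lower similarity dimension $D_\ell$ of $\Phi$ be the unique real solution of $$\frac1{m_M}\,(r_M^{-1})^{D_\ell}+\sum_{k=1}^{M-1}\frac{m_k}{m_M}\Big(\frac{r_k}{r_M}\Big)^{D_\ell}=1 .$$ Let $\zeta_\Phi(s)=\big(1-\sum_{\varphi\in\Phi}\lambda_\varphi^s\big)^{-1}$ be the scaling zeta function of $\Phi$. For $R:(0,\infty)\to\mathbb R$ and $\delta>0$ let $\zeta_R(s)=\zeta_R(s;\delta)=\int_0^\delta t^{s-1}R(t)\,dt$. Both functions are identified with their analytic continuations. Write $\mathbb H_\sigma=\{s\in\mathbb C:\operatorname{Re}s>\sigma\}$. *Definitions.* A *screen* is a bounded Lipschitz function $S:\mathbb R\to\mathbb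 R$, identified with $\{S(\tau)+i\tau:\tau\in\mathbb R\}$; its *window* is $W=\{s:\operatorname{Re}s\ge S(\operatorname{Im}s)\}$. A *sequence of admissible heights* is a sequence $(\tau_n)_{n\in\mathbb Z}$ of reals with $\tau_n\to\pm\infty$ as $n\to\pm\infty$ and $\tau_{-n}<0<\tau_n$ for $n\ge1$. Two functions $f,g$ that are holomorphic in a common right half-plane are *jointly languid* (with exponent $\kappa=0$) on the screen $S$ if $S$ lies in the largest open right half-plane to which both continue analytically up to a discrete set of singularities, and there is one sequence of admissible heights $(\tau_n)$ such that, for each $h\in\{f,g\}$: * $h$ is holomorphic in some $\mathbb H_D\subseteq W$ and continues analytically to a neighbourhood of $W$, except for a discrete set of singularities, none of which lies on $S$; * (L1) for some $C>0$ and $\beta>D$, every segment $[S(\tau_n)+i\tau_n,\ \beta+i\tau_n]$, $n\in\mathbb Z$, contains no singularity of $h$, and $|h|\le C$ on it; * (L2) for some $C>0$, $|h(S(\tau)+i\tau)|\le C$ for all real $\tau$ with $|\tau|\ge1$. The function $R$ is an *admissible remainder* for $\Phi$ if the integral $\zeta_R$ converges and is holomorphic in some right half-plane and there is a screen $S$ on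 which $\zeta_\Phi$ and $\zeta_R$ are jointly languid; every such $S$ is called an *admissible screen*. *Theorem.* Let $R:(0,\infty)\to\mathbb R$ be continuous and let $\sigma_0<D_\ell$ be a real number with $R(t)=O(t^{-\sigma_0})$ as $t\to0^+$. Then, for every $\delta>0$, $R$ is an admissible remainder for $\Phi$, and for every $\varepsilon$ with $0<\varepsilon<D_\ell-\sigma_0$ the constant screen $S_\varepsilon(\tau)\equiv\sigma_0+\varepsilon$ is admissible. -/

import Mathlib

open Set Filter Topology Asymptotics

noncomputable section

/-! ### Self-similar systems -/

/-- A self-similar system on a metric space: a nonempty finite set of contractive similitudes.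
Mathlib's `Dilation`s are the maps with `dist (φ x) (φ y) = r * dist x y` for some `r > 0`;
`Dilation.ratio φ` is this scaling ratio `r` as soon as `X` has two points. (It is `1` on a space
with at most one point, where a scaling ratio is not determined; such spaces carry no system.) -/
structure SelfSimilarSystem (X : Type*) [MetricSpace X] where
  maps : Finset (X →ᵈ X)
  nonempty : maps.Nonempty
  ratio_lt_one : ∀ φ ∈ maps, Dilation.ratio φ < 1

/-! ### Scaling operators and their zeta functions -/

/-- A scaling operator `∑ a_k M_{λ_k}`, `M_λ[f](x) = f (x / λ)`, given by the finitely supported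
function `λ_k ↦ a_k` on the positive reals. -/
abbrev ScalingOperator : Type := {r : ℝ // 0 < r} →₀ ℝ

/-- The action `L[f](x) = ∑ a_k f (x / λ_k)`. -/
def ScalingOperator.apply (L : ScalingOperator) (f : ℝ → ℝ) (x : ℝ) : ℝ :=
  L.sum fun r a => a * f (x / r.1)

/-- The scaling zeta function `1 / (1 - ∑ a_k λ_k ^ s)`. (At a zero of the denominator Lean's value
is `0`; such points have to be treated as singularities wherever this function is used.) -/
def ScalingOperator.zeta (L : ScalingOperator) (s : ℂ) : ℂ :=
  1 / (1 - L.sum fun r a => (a : ℂ) * ((r.1 : ℝ) : ℂ) ^ s)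

namespace SelfSimilarSystem

variable {X : Type*} [MetricSpace X] (Φ : SelfSimilarSystem X)

/-- The scaling operator `L_Φ = ∑_{φ ∈ Φ} M_{λ_φ}`. -/
def scalingOperator : ScalingOperator :=
  ∑ φ ∈ Φ.maps, Finsupp.single ⟨(Dilation.ratio φ : ℝ), by exact_mod_cast Dilation.ratio_pos φ⟩ 1

/-- The set of distinct scaling ratios `r_1 > ... > r_M`. -/
def ratios : Finset ℝ := Φ.maps.image fun φ => (Dilation.ratio φ : ℝ)

/-- The multiplicity of a scaling ratio. -/
def mult (r : ℝ) : ℕ := (Φ.maps.filter fun φ => (Dilation.ratio φ : ℝ) = r).card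

/-- The smallest scaling ratio `r_M`. -/
def minRatio : ℝ := Φ.ratios.min' (Φ.nonempty.image _)

/-- The function
`p(t) = (1 / m_M) (1 / r_M) ^ t + ∑_{k < M} (m_k / m_M) (r_k / r_M) ^ t`. -/
def lowerPoly (t : ℝ) : ℝ :=
  1 / (Φ.mult Φ.minRatio : ℝ) * (Φ.minRatio⁻¹) ^ t +
    ∑ r ∈ Φ.ratios.erase Φ.minRatio,
      (Φ.mult r : ℝ) / (Φ.mult Φ.minRatio : ℝ) * (r / Φ.minRatio) ^ t

theorem minRatio_mem : Φ.minRatio ∈ Φ.ratios := Finset.min'_mem _ _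

theorem ratios_pos {r : ℝ} (hr : r ∈ Φ.ratios) : 0 < r := by
  obtain ⟨φ, -, rfl⟩ := Finset.mem_image.1 hr
  exact_mod_cast Dilation.ratio_pos φ

theorem ratios_lt_one {r : ℝ} (hr : r ∈ Φ.ratios) : r < 1 := by
  obtain ⟨φ, hφ, rfl⟩ := Finset.mem_image.1 hr
  exact_mod_cast Φ.ratio_lt_one φ hφ

theorem mult_pos {r : ℝ} (hr : r ∈ Φ.ratios) : 0 < Φ.mult r := by
  obtain ⟨φ, hφ, rfl⟩ := Finset.mem_image.1 hr
  exact Finset.card_pos.2 ⟨φ, Finset.mem_filter.2 ⟨hφ, rfl⟩⟩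

theorem one_lt_div_minRatio {r : ℝ} (hr : r ∈ Φ.ratios.erase Φ.minRatio) :
    1 < r / Φ.minRatio := by
  rw [one_lt_div (Φ.ratios_pos Φ.minRatio_mem)]
  exact lt_of_le_of_ne (Finset.min'_le _ _ (Finset.mem_of_mem_erase hr))
    (Finset.ne_of_mem_erase hr).symm

theorem one_lt_inv_minRatio : 1 < Φ.minRatio⁻¹ :=
  (one_lt_inv₀ (Φ.ratios_pos Φ.minRatio_mem)).2 (Φ.ratios_lt_one Φ.minRatio_mem)

/-- The defining equation of the lower similarity dimension has exactly one real solution. -/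
theorem existsUnique_lowerPoly_eq_one : ∃! t : ℝ, Φ.lowerPoly t = 1 := by
  have hm : (0 : ℝ) < 1 / (Φ.mult Φ.minRatio : ℝ) :=
    one_div_pos.2 (by exact_mod_cast Φ.mult_pos Φ.minRatio_mem)
  have hb := Φ.one_lt_inv_minRatio
  have hmono : StrictMono Φ.lowerPoly := by
    intro x y hxy
    refine add_lt_add_of_lt_of_le
      (mul_lt_mul_of_pos_left (Real.rpow_lt_rpow_of_exponent_lt hb hxy) hm)
      (Finset.sum_le_sum fun r hr => mul_le_mul_of_nonneg_left
        (Real.rpow_le_rpow_of_exponent_le (Φ.one_lt_div_minRatio hr).le hxy.le) (by positivity))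
  have hcont : Continuous Φ.lowerPoly := by
    refine Continuous.add (continuous_const.mul (Real.continuous_const_rpow (by positivity)))
      (continuous_finsetSum _ fun r hr => continuous_const.mul
        (Real.continuous_const_rpow (by linarith [Φ.one_lt_div_minRatio hr])))
  have htop : Tendsto Φ.lowerPoly atTop atTop := by
    refine tendsto_atTop_mono (fun t => ?_)
      ((tendsto_rpow_atTop_of_base_gt_one _ hb).const_mul_atTop hm)
    refine le_add_of_nonneg_right (Finset.sum_nonneg fun r hr => ?_)
    have := (zero_lt_one.trans (Φ.one_lt_div_minRatio hr)).le
    positivity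
  have hbot : Tendsto Φ.lowerPoly atBot (𝓝 0) := by
    have h := ((tendsto_rpow_atBot_of_base_gt_one _ hb).const_mul
        (1 / (Φ.mult Φ.minRatio : ℝ))).add
      (tendsto_finsetSum (Φ.ratios.erase Φ.minRatio) fun r hr =>
        (tendsto_rpow_atBot_of_base_gt_one _ (Φ.one_lt_div_minRatio hr)).const_mul
          ((Φ.mult r : ℝ) / (Φ.mult Φ.minRatio : ℝ)))
    simp only [mul_zero, Finset.sum_const_zero, add_zero] at h
    exact h
  obtain ⟨a, ha⟩ := (hbot.eventually_le_const zero_lt_one).exists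
  obtain ⟨b, hb'⟩ := (htop.eventually_ge_atTop 1).exists
  obtain ⟨t, ht⟩ := mem_range_of_exists_le_of_exists_ge hcont ⟨a, ha⟩ ⟨b, hb'⟩
  exact ⟨t, ht, fun y hy => hmono.injective (hy.trans ht.symm)⟩

/-- The lower similarity dimension `D_ℓ` of a self-similar system: the unique real solution of
`p(D_ℓ) = 1`. -/
def lowerSimDim : ℝ := Φ.existsUnique_lowerPoly_eq_one.choose

theorem lowerPoly_lowerSimDim : Φ.lowerPoly Φ.lowerSimDim = 1 :=
  Φ.existsUnique_lowerPoly_eq_one.choose_spec.1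

end SelfSimilarSystem

/-! ### Truncated Mellin transforms -/

/-- `R` times the characteristic function of `(0, δ]`, with complex values. -/
def truncate (R : ℝ → ℝ) (δ : ℝ) : ℝ → ℂ := (Ioc 0 δ).indicator fun t => (R t : ℂ)

/-- The truncated Mellin transform `ζ_R(s; δ) = ∫_0^δ t ^ (s - 1) R(t) dt`. -/
def remainderZeta (R : ℝ → ℝ) (δ : ℝ) (s : ℂ) : ℂ := mellin (truncate R δ) s

/-! ### Half-planes, screens, windows, analytic continuation -/

/-- The open right half-plane `Re s > σ`; `σ = ⊥` gives the whole plane. -/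
def halfPlane (σ : EReal) : Set ℂ := {s | σ < (s.re : EReal)}

/-- A screen is (the graph of) a bounded Lipschitz function `S : ℝ → ℝ`. -/
def IsScreen (S : ℝ → ℝ) : Prop :=
  (∃ M : ℝ, ∀ τ, |S τ| ≤ M) ∧ ∃ K : NNReal, LipschitzWith K S

/-- The point `S(τ) + iτ` of a screen. -/
def screenPoint (S : ℝ → ℝ) (τ : ℝ) : ℂ := ⟨S τ, τ⟩

/-- The window `Re s ≥ S(Im s)` of a screen. -/
def window (S : ℝ → ℝ) : Set ℂ := {s | S s.im ≤ s.re}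

/-- `F` is an analytic continuation to the open set `U`, except for a discrete set `P` of singular
points, of the function `f`, which is holomorphic in the half-plane `Re s > D`. -/
structure IsContinuation (f : ℂ → ℂ) (D : ℝ) (U : Set ℂ) (F : ℂ → ℂ) (P : Set ℂ) : Prop where
  isOpen : IsOpen U
  holomorphic : DifferentiableOn ℂ f (halfPlane D)
  eqOn : EqOn F f (halfPlane D)
  discrete : ∀ z ∈ U, ¬ AccPt z (𝓟 P)
  differentiableOn : DifferentiableOn ℂ F (U \ P)

/-- `F`, with singular set `P`, is an extension with respect to the screen `S` of the function `f`,
which is holomorphic in the half-plane `Re s > D`: it is a continuation of `f` to a neighbourhood of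
the window of `S`, the window contains the half-plane, and no singular point lies on the screen. -/
def IsScreenExtension (f : ℂ → ℂ) (D : ℝ) (S : ℝ → ℝ) (F : ℂ → ℂ) (P : Set ℂ) : Prop :=
  (∃ U, window S ⊆ U ∧ IsContinuation f D U F P) ∧ halfPlane D ⊆ window S ∧
    ∀ τ, screenPoint S τ ∉ P

/-! ### Languid growth -/

/-- Sequences of admissible heights. -/
def AdmissibleHeights (T : ℤ → ℝ) : Prop :=
  Tendsto T atTop atTop ∧ Tendsto T atBot atBot ∧ ∀ n : ℤ, 1 ≤ n → T (-n) < 0 ∧ 0 < T n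

/-- Languidity hypothesis L1 for `f` with exponent `κ` with respect to the screen `S`, using the
sequence of admissible heights `T`: the extension of `f` has no singular point on the segments
`[S(T_n) + i T_n, β + i T_n]`, and is bounded by `C (|T_n| + 1) ^ κ` there. -/
def LanguidL1 (f : ℂ → ℂ) (κ : ℝ) (S : ℝ → ℝ) (T : ℤ → ℝ) : Prop :=
  AdmissibleHeights T ∧
  ∃ (D : ℝ) (F : ℂ → ℂ) (P : Set ℂ), IsScreenExtension f D S F P ∧
    ∃ C > 0, ∃ β > D, ∀ n : ℤ, ∀ σ ∈ Icc (S (T n)) β,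
      (⟨σ, T n⟩ : ℂ) ∉ P ∧ ‖F ⟨σ, T n⟩‖ ≤ C * (|T n| + 1) ^ κ

/-- Languidity hypothesis L2 for `f` with exponent `κ` with respect to the screen `S`. -/
def LanguidL2 (f : ℂ → ℂ) (κ : ℝ) (S : ℝ → ℝ) : Prop :=
  ∃ (D : ℝ) (F : ℂ → ℂ) (P : Set ℂ), IsScreenExtension f D S F P ∧
    ∃ C > 0, ∀ τ : ℝ, 1 ≤ |τ| → ‖F (screenPoint S τ)‖ ≤ C * |τ| ^ κ

/-- `f` admits an analytic continuation to the half-plane `Re s > σ`, except perhaps for a discrete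
set of singular points. -/
def ExtendsToHalfPlane (f : ℂ → ℂ) (σ : EReal) : Prop :=
  ∃ (D : ℝ) (F : ℂ → ℂ) (P : Set ℂ), IsContinuation f D (halfPlane σ) F P

/-- The abscissa of the half-plane of maximal joint extension of `f` and `g`, that is, of the
largest half-plane to which both functions extend. (By uniqueness of analytic continuation the
infimum is attained as soon as the set is nonempty; it is `⊤` otherwise.) -/
def jointAbscissa (f g : ℂ → ℂ) : EReal :=
  sInf {σ : EReal | σ < ⊤ ∧ ExtendsToHalfPlane f σ ∧ ExtendsToHalfPlane g σ}

/-- `f` and `g` are jointly languid with exponent `κ` with respect to the screen `S`. -/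
structure JointlyLanguidOn (f g : ℂ → ℂ) (κ : ℝ) (S : ℝ → ℝ) : Prop where
  holomorphic : ∃ σ₁ : ℝ,
    DifferentiableOn ℂ f (halfPlane σ₁) ∧ DifferentiableOn ℂ g (halfPlane σ₁)
  isScreen : IsScreen S
  mem_halfPlane : ∀ τ, screenPoint S τ ∈ halfPlane (jointAbscissa f g)
  languidL1 : ∃ T : ℤ → ℝ, LanguidL1 f κ S T ∧ LanguidL1 g κ S T
  languidL2 : LanguidL2 f κ S ∧ LanguidL2 g κ S

/-! ### Admissible remainders and screens -/

/-- `S` is an admissible screen for the remainder `R` and the scaling operator `L`: the integral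
`ζ_R(·; δ)` converges and is holomorphic in some half-plane, and `ζ_L` and `ζ_R(·; δ)` are jointly
languid with exponent `0` with respect to `S`. -/
def IsAdmissibleScreen (L : ScalingOperator) (R : ℝ → ℝ) (δ : ℝ) (S : ℝ → ℝ) : Prop :=
  (∃ σ : ℝ, (∀ s ∈ halfPlane σ, MellinConvergent (truncate R δ) s) ∧
    DifferentiableOn ℂ (remainderZeta R δ) (halfPlane σ)) ∧
  JointlyLanguidOn L.zeta (remainderZeta R δ) 0 S

/-- `R` is an admissible remainder for the scaling operator `L`. -/
def IsAdmissibleRemainder (L : ScalingOperator) (R : ℝ → ℝ) (δ : ℝ) : Prop :=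
  ∃ S : ℝ → ℝ, IsAdmissibleScreen L R δ S

end

open MeasureTheory Complex

/-! ### The denominator of the scaling zeta function -/

namespace SelfSimilarSystem

/-! Write `ζ_Φ = 1 / f` with `f` the exponential polynomial `zetaDenom`, and let `p` be `lowerPoly`.
On `Re s = σ` the reverse triangle inequality gives `|f| ≥ m_M r_M ^ σ (1 - p(σ))`. Since `p` is
strictly increasing and `p(D_ℓ) = 1`, `f` is bounded away from zero on each vertical line to the
left of `D_ℓ` (`exists_pos_le_norm_zetaDenom`), which is L2 for `ζ_Φ`.

Zeros of `f` may lie to the right of the screen, so L1 needs heights that avoid them. Some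
horizontal line misses the countable zero set, `|f|` has a positive lower bound on a compact segment
of it, and almost periodicity of `f` in the imaginary direction carries half of that bound to
arbitrarily large heights of both signs (`exists_admissibleHeights`).

The integral `ζ_R` converges absolutely for `Re s > σ₀`, hence is bounded on closed vertical strips
there (`exists_norm_mellin_le`). It constrains no height, so the heights found for `f` serve both
functions. -/

/-- The exponential polynomial `1 - ∑ m_k r_k ^ s`, whose reciprocal is the scaling zeta
function. -/
noncomputable def zetaDenom {X : Type*} [MetricSpace X] (Φ : SelfSimilarSystem X) (s : ℂ) : ℂ :=
  1 - ∑ r ∈ Φ.ratios, (Φ.mult r : ℂ) * (r : ℂ) ^ s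

variable {X : Type*} [MetricSpace X] (Φ : SelfSimilarSystem X)

theorem zeta_scalingOperator (s : ℂ) : Φ.scalingOperator.zeta s = (Φ.zetaDenom s)⁻¹ := by
  have h : (Φ.scalingOperator.sum fun r a => (a : ℂ) * ((r.1 : ℝ) : ℂ) ^ s) =
      ∑ φ ∈ Φ.maps, (((Dilation.ratio φ : ℝ)) : ℂ) ^ s := by
    rw [scalingOperator, ← Finsupp.sum_finsetSum_index (by simp) (by intros; push_cast; ring)]
    refine Finset.sum_congr rfl fun φ _ => ?_
    rw [Finsupp.sum_single_index (by simp)]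
    simp
  -- Grouping the maps by scaling ratio produces the multiplicities as fibre cardinalities.
  have h2 := Finset.sum_comp (s := Φ.maps) (fun r : ℝ => (r : ℂ) ^ s)
    fun φ => (Dilation.ratio φ : ℝ)
  rw [ScalingOperator.zeta, h, one_div, zetaDenom, h2]
  simp [mult, ratios]

theorem norm_mult_mul_cpow {r : ℝ} (hr : r ∈ Φ.ratios) (s : ℂ) :
    ‖(Φ.mult r : ℂ) * (r : ℂ) ^ s‖ = Φ.mult r * r ^ s.re := by
  rw [norm_mul, norm_natCast, norm_cpow_eq_rpow_re_of_pos (Φ.ratios_pos hr)]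

theorem differentiable_zetaDenom : Differentiable ℂ Φ.zetaDenom := by
  unfold zetaDenom
  refine (differentiable_const _).sub (Differentiable.fun_sum fun r hr => ?_)
  exact (differentiable_const _).mul (differentiable_id.const_cpow
    (Or.inl (ofReal_ne_zero.2 (Φ.ratios_pos hr).ne')))

theorem lowerPoly_strictMono : StrictMono Φ.lowerPoly := by
  have hm : (0 : ℝ) < 1 / (Φ.mult Φ.minRatio : ℝ) :=
    one_div_pos.2 (by exact_mod_cast Φ.mult_pos Φ.minRatio_mem)
  intro x y hxy
  exact add_lt_add_of_lt_of_le
    (mul_lt_mul_of_pos_left (Real.rpow_lt_rpow_of_exponent_lt Φ.one_lt_inv_minRatio hxy) hm)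
    (Finset.sum_le_sum fun r hr => mul_le_mul_of_nonneg_left
      (Real.rpow_le_rpow_of_exponent_le (Φ.one_lt_div_minRatio hr).le hxy.le) (by positivity))

/-- Multiplying `p` by the smallest term of the exponential polynomial clears its denominators. -/
theorem mult_mul_rpow_mul_lowerPoly (t : ℝ) :
    Φ.mult Φ.minRatio * Φ.minRatio ^ t * Φ.lowerPoly t =
      1 + ∑ r ∈ Φ.ratios.erase Φ.minRatio, Φ.mult r * r ^ t := by
  have hr := Φ.ratios_pos Φ.minRatio_mem
  have hm : (Φ.mult Φ.minRatio : ℝ) ≠ 0 := by exact_mod_cast (Φ.mult_pos Φ.minRatio_mem).ne'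
  have hp : Φ.minRatio ^ t ≠ 0 := (Real.rpow_pos_of_pos hr t).ne'
  rw [lowerPoly, mul_add, Finset.mul_sum]
  congr 1
  · rw [Real.inv_rpow hr.le]
    field_simp
  · refine Finset.sum_congr rfl fun r hr' => ?_
    rw [Real.div_rpow (Φ.ratios_pos (Finset.mem_of_mem_erase hr')).le hr.le]
    field_simp

/-- To the left of the lower similarity dimension the term of the smallest ratio dominates. -/
theorem le_norm_zetaDenom (s : ℂ) :
    Φ.mult Φ.minRatio * Φ.minRatio ^ s.re * (1 - Φ.lowerPoly s.re) ≤ ‖Φ.zetaDenom s‖ := by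
  have h1 : Φ.zetaDenom s = (1 - ∑ r ∈ Φ.ratios.erase Φ.minRatio, (Φ.mult r : ℂ) * (r : ℂ) ^ s) -
      (Φ.mult Φ.minRatio : ℂ) * (Φ.minRatio : ℂ) ^ s := by
    rw [zetaDenom, ← Finset.sum_erase_add _ _ Φ.minRatio_mem]
    ring
  have h2 : ‖(1 : ℂ) - ∑ r ∈ Φ.ratios.erase Φ.minRatio, (Φ.mult r : ℂ) * (r : ℂ) ^ s‖ ≤
      1 + ∑ r ∈ Φ.ratios.erase Φ.minRatio, Φ.mult r * r ^ s.re := by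
    refine (norm_sub_le _ _).trans (add_le_add (by simp) ((norm_sum_le _ _).trans
      (Finset.sum_le_sum fun r hr => ?_)))
    exact (Φ.norm_mult_mul_cpow (Finset.mem_of_mem_erase hr) s).le
  have h3 := norm_sub_norm_le ((Φ.mult Φ.minRatio : ℂ) * (Φ.minRatio : ℂ) ^ s)
    (1 - ∑ r ∈ Φ.ratios.erase Φ.minRatio, (Φ.mult r : ℂ) * (r : ℂ) ^ s)
  rw [norm_sub_rev _ (1 - _), ← h1, Φ.norm_mult_mul_cpow Φ.minRatio_mem] at h3
  rw [mul_sub, mul_one, mult_mul_rpow_mul_lowerPoly]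
  linarith

/-- The bound in `le_norm_zetaDenom` depends on `s` only through its real part, and it is positive
because `p(σ) < p(D_ℓ) = 1`. -/
theorem exists_pos_le_norm_zetaDenom {σ : ℝ} (hσ : σ < Φ.lowerSimDim) :
    ∃ c > 0, ∀ s : ℂ, s.re = σ → c ≤ ‖Φ.zetaDenom s‖ := by
  refine ⟨_, ?_, fun s hs => hs ▸ Φ.le_norm_zetaDenom s⟩
  have h := Φ.lowerPoly_strictMono hσ
  rw [Φ.lowerPoly_lowerSimDim] at h
  have hm : (0 : ℝ) < Φ.mult Φ.minRatio := by exact_mod_cast Φ.mult_pos Φ.minRatio_mem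
  exact mul_pos (mul_pos hm (Real.rpow_pos_of_pos (Φ.ratios_pos Φ.minRatio_mem) _)) (sub_pos.2 h)

/-- The exponential polynomial has no zeros far to the right. -/
theorem eventually_zetaDenom_ne_zero :
    ∀ᶠ D : ℝ in atTop, ∀ s : ℂ, D < s.re → Φ.zetaDenom s ≠ 0 := by
  have h : Tendsto (fun σ : ℝ => ∑ r ∈ Φ.ratios, Φ.mult r * r ^ σ) atTop (𝓝 0) := by
    have := tendsto_finsetSum Φ.ratios fun r hr =>
      (tendsto_rpow_atTop_of_base_lt_one r (by linarith [Φ.ratios_pos hr])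
        (Φ.ratios_lt_one hr)).const_mul (Φ.mult r : ℝ)
    simpa using this
  obtain ⟨D₀, hD₀⟩ := eventually_atTop.1 (h.eventually_lt_const zero_lt_one)
  filter_upwards [eventually_ge_atTop D₀] with D hD s hs h0
  have h1 : ‖∑ r ∈ Φ.ratios, (Φ.mult r : ℂ) * (r : ℂ) ^ s‖ < 1 := by
    refine (norm_sum_le _ _).trans_lt ?_
    rw [Finset.sum_congr rfl fun r hr => Φ.norm_mult_mul_cpow hr s]
    exact hD₀ _ (hD.trans hs.le)
  rw [← sub_eq_zero.1 h0] at h1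
  simp at h1

/-- The zeros of the exponential polynomial do not accumulate. -/
theorem zetaDenom_ne_zero_mem_codiscrete : {s | Φ.zetaDenom s = 0}ᶜ ∈ codiscrete ℂ := by
  obtain ⟨D, hD⟩ := Φ.eventually_zetaDenom_ne_zero.exists
  -- The value at `D + 1` is nonzero, so this entire function is not identically zero.
  exact AnalyticOnNhd.preimage_zero_mem_codiscrete
    (fun z _ => Φ.differentiable_zetaDenom.analyticAt z) (hD ((D + 1 : ℝ) : ℂ) (by simp))

/-- Some horizontal line is free of zeros of the exponential polynomial. -/
theorem exists_height_zetaDenom_ne_zero : ∃ τ : ℝ, ∀ s : ℂ, s.im = τ → Φ.zetaDenom s ≠ 0 := by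
  obtain ⟨-, hd⟩ := compl_mem_codiscrete_iff.1 Φ.zetaDenom_ne_zero_mem_codiscrete
  -- A discrete set of zeros is countable, so the imaginary parts of the zeros cannot exhaust `ℝ`.
  have hc : {s | Φ.zetaDenom s = 0}.Countable :=
    (HereditarilyLindelofSpace.isLindelof _).countable_of_isDiscrete hd
  have hne : (im '' {s | Φ.zetaDenom s = 0})ᶜ.Nonempty := by
    rw [nonempty_compl]
    intro h
    exact not_countable_univ (h ▸ hc.image im)
  obtain ⟨τ, hτ⟩ := hne
  exact ⟨τ, fun s hs h0 => hτ ⟨s, h0, hs⟩⟩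

/-- Arbitrarily large common almost periods of the functions `t ↦ r_k ^ (i t)`. -/
theorem exists_almost_period {η : ℝ} (hη : 0 < η) (A : ℝ) :
    ∃ t : ℝ, A < t ∧ ∀ r ∈ Φ.ratios, ‖(r : ℂ) ^ (t * I) - 1‖ < η := by
  let x : Φ.ratios → Circle := fun r => Circle.exp (Real.log r)
  -- Recurrence in a compact torus: the powers of a point return to each neighbourhood of the
  -- identity for arbitrarily large exponents. Such an exponent is the almost period.
  have h := mapClusterPt_one_atTop_pow x
  have hU : {y : Φ.ratios → Circle | ∀ r, ‖(y r : ℂ) - 1‖ < η} ∈ 𝓝 1 := by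
    refine IsOpen.mem_nhds ?_ (by simpa using fun _ _ => hη)
    simp only [ofPred_forall]
    exact isOpen_iInter_of_finite fun r => isOpen_lt (by fun_prop) continuous_const
  obtain ⟨n, hn, hA⟩ := ((h.frequently hU).and_eventually
    (tendsto_natCast_atTop_atTop.eventually_gt_atTop A)).exists
  refine ⟨n, hA, fun r hr => ?_⟩
  convert hn ⟨r, hr⟩ using 2
  have h0 : (r : ℂ) ≠ 0 := ofReal_ne_zero.2 (Φ.ratios_pos hr).ne'
  simp only [Pi.pow_apply, x, Circle.coe_pow, Circle.coe_exp, cpow_def_of_ne_zero h0,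
    ofReal_log (Φ.ratios_pos hr).le, ← Complex.exp_nat_mul]
  push_cast
  congr 2
  ring

/-- Negatives of almost periods are almost periods, with the same error; this supplies the heights
tending to `-∞`. -/
theorem norm_cpow_neg_mul_I_sub_one {r : ℝ} (hr : 0 < r) (t : ℝ) :
    ‖(r : ℂ) ^ ((-t : ℝ) * I) - 1‖ = ‖(r : ℂ) ^ (t * I) - 1‖ := by
  have h1 : ‖(r : ℂ) ^ ((-t : ℝ) * I)‖ = 1 := by
    rw [norm_cpow_eq_rpow_re_of_pos hr]
    simp
  have h2 : (r : ℂ) ^ ((-t : ℝ) * I) * (r : ℂ) ^ (t * I) = 1 := by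
    rw [← cpow_add _ _ (ofReal_ne_zero.2 hr.ne')]
    simp
  calc _ = ‖(r : ℂ) ^ ((-t : ℝ) * I) * (1 - (r : ℂ) ^ (t * I))‖ := by
        rw [mul_sub, h2, mul_one]
    _ = _ := by rw [norm_mul, h1, one_mul, norm_sub_rev]

theorem norm_zetaDenom_add_sub_le (s : ℂ) {t η : ℝ}
    (ht : ∀ r ∈ Φ.ratios, ‖(r : ℂ) ^ (t * I) - 1‖ ≤ η) :
    ‖Φ.zetaDenom (s + t * I) - Φ.zetaDenom s‖ ≤ (∑ r ∈ Φ.ratios, Φ.mult r * r ^ s.re) * η := by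
  have h : Φ.zetaDenom (s + t * I) - Φ.zetaDenom s =
      ∑ r ∈ Φ.ratios, -((Φ.mult r : ℂ) * (r : ℂ) ^ s * ((r : ℂ) ^ (t * I) - 1)) := by
    rw [zetaDenom, zetaDenom, sub_sub_sub_cancel_left, ← Finset.sum_sub_distrib]
    refine Finset.sum_congr rfl fun r hr => ?_
    rw [cpow_add _ _ (ofReal_ne_zero.2 (Φ.ratios_pos hr).ne')]
    ring
  rw [h, Finset.sum_mul]
  refine (norm_sum_le _ _).trans (Finset.sum_le_sum fun r hr => ?_)
  rw [norm_neg, norm_mul, Φ.norm_mult_mul_cpow hr]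
  have := (Φ.ratios_pos hr).le
  exact mul_le_mul_of_nonneg_left (ht r hr) (by positivity)

/-- There are admissible heights along which the exponential polynomial is bounded away from zero,
uniformly on horizontal segments. -/
theorem exists_admissibleHeights (a β : ℝ) :
    ∃ T : ℤ → ℝ, AdmissibleHeights T ∧
      ∃ c > 0, ∀ n : ℤ, ∀ σ ∈ Icc a β, c ≤ ‖Φ.zetaDenom ⟨σ, T n⟩‖ := by
  obtain ⟨τ, hτ⟩ := Φ.exists_height_zetaDenom_ne_zero
  have hcont : ContinuousOn (fun σ : ℝ => ‖Φ.zetaDenom ⟨σ, τ⟩‖) (Icc a β) := by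
    refine (Φ.differentiable_zetaDenom.continuous.comp ?_).norm.continuousOn
    simp only [mk_eq_add_mul_I]
    fun_prop
  obtain ⟨c, hc, hcb⟩ : ∃ c > 0, ∀ σ ∈ Icc a β, c ≤ ‖Φ.zetaDenom ⟨σ, τ⟩‖ :=
    isCompact_Icc.exists_forall_le' hcont fun σ _ => norm_pos_iff.2 (hτ _ rfl)
  set B : ℝ := ∑ r ∈ Φ.ratios, Φ.mult r * r ^ a with hB
  have hB0 : 0 ≤ B := Finset.sum_nonneg fun r hr => by
    have := (Φ.ratios_pos hr).le
    positivity
  -- With this error a shift changes the denominator by at most `B * c / (2 * (B + 1)) ≤ c / 2`; the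
  -- `+ 1` covers `B = 0`.
  have hη : 0 < c / (2 * (B + 1)) := by positivity
  choose t ht htη using Φ.exists_almost_period hη
  have hpert : ∀ u : ℝ, (∀ r ∈ Φ.ratios, ‖(r : ℂ) ^ (u * I) - 1‖ ≤ c / (2 * (B + 1))) →
      ∀ σ ∈ Icc a β, c / 2 ≤ ‖Φ.zetaDenom ⟨σ, τ + u⟩‖ := by
    intro u hu σ hσ
    have h1 := Φ.norm_zetaDenom_add_sub_le ⟨σ, τ⟩ hu
    have h2 : ∑ r ∈ Φ.ratios, Φ.mult r * r ^ σ ≤ B :=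
      Finset.sum_le_sum fun r hr => mul_le_mul_of_nonneg_left
        (Real.rpow_le_rpow_of_exponent_ge (Φ.ratios_pos hr) (Φ.ratios_lt_one hr).le hσ.1)
        (by positivity)
    have h3 : (∑ r ∈ Φ.ratios, Φ.mult r * r ^ σ) * (c / (2 * (B + 1))) ≤ c / 2 := by
      calc _ ≤ (B + 1) * (c / (2 * (B + 1))) :=
            mul_le_mul_of_nonneg_right (by linarith) hη.le
        _ = c / 2 := by field_simp
    have h4 : (⟨σ, τ⟩ : ℂ) + u * I = ⟨σ, τ + u⟩ := by
      apply Complex.ext <;> simp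
    rw [h4, norm_sub_rev] at h1
    have h5 := norm_sub_norm_le (Φ.zetaDenom ⟨σ, τ⟩) (Φ.zetaDenom ⟨σ, τ + u⟩)
    have h6 := hcb σ hσ
    simp only at h1
    linarith
  -- A period larger than `|τ| + |n|` makes the shifted height exceed `|n|` in absolute value, with
  -- the sign of the shift.
  let N : ℤ → ℝ := fun n => |τ| + |(n : ℝ)|
  refine ⟨fun n => if 0 ≤ n then τ + t (N n) else τ + -t (N n), ⟨?_, ?_, ?_⟩, c / 2, by positivity,
    fun n σ hσ => ?_⟩
  · refine tendsto_atTop_mono' _ ?_ tendsto_intCast_atTop_atTop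
    filter_upwards [eventually_ge_atTop 0] with n hn
    rw [if_pos hn]
    have := ht (N n)
    linarith [neg_abs_le τ, le_abs_self (n : ℝ)]
  · refine tendsto_atBot_mono' _ ?_ (tendsto_intCast_atBot_iff.2 tendsto_id)
    filter_upwards [eventually_lt_atBot 0] with n hn
    rw [if_neg hn.not_ge, id]
    have := ht (N n)
    linarith [le_abs_self τ, neg_abs_le (n : ℝ)]
  · intro n hn
    simp only [if_neg (show ¬ 0 ≤ -n by lia), if_pos (show 0 ≤ n by lia)]
    have h1 := ht (N n)
    have h2 := ht (N (-n))
    constructor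
    · linarith [le_abs_self τ, abs_nonneg ((-n : ℤ) : ℝ)]
    · linarith [neg_abs_le τ, abs_nonneg (n : ℝ)]
  · dsimp only
    split_ifs
    · exact hpert _ (fun r hr => (htη _ r hr).le) σ hσ
    · refine hpert _ (fun r hr => ?_) σ hσ
      rw [norm_cpow_neg_mul_I_sub_one (Φ.ratios_pos hr)]
      exact (htη _ r hr).le

/-- The scaling zeta function continues to the whole plane, the zeros of the exponential polynomial
being its only singularities. -/
theorem isContinuation_zeta {D : ℝ} (hD : ∀ s : ℂ, D < s.re → Φ.zetaDenom s ≠ 0) {U : Set ℂ}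
    (hU : IsOpen U) :
    IsContinuation Φ.scalingOperator.zeta D U Φ.scalingOperator.zeta
      {s | Φ.zetaDenom s = 0} := by
  have hd : ∀ s, Φ.zetaDenom s ≠ 0 → DifferentiableAt ℂ Φ.scalingOperator.zeta s := by
    intro s hs
    rw [funext Φ.zeta_scalingOperator]
    exact (Φ.differentiable_zetaDenom s).inv hs
  refine ⟨hU, fun s hs => (hd s (hD s ?_)).differentiableWithinAt, fun _ _ => rfl, fun z _ => ?_,
    fun s hs => (hd s hs.2).differentiableWithinAt⟩
  · exact EReal.coe_lt_coe_iff.1 hs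
  · simpa using mem_codiscrete_accPt.1 Φ.zetaDenom_ne_zero_mem_codiscrete z

theorem norm_zeta_le {s : ℂ} {c : ℝ} (hc : 0 < c) (h : c ≤ ‖Φ.zetaDenom s‖) :
    ‖Φ.scalingOperator.zeta s‖ ≤ c⁻¹ := by
  rw [zeta_scalingOperator, norm_inv]
  exact inv_anti₀ hc h

end SelfSimilarSystem

/-! ### The truncated Mellin transform of the remainder -/

section Remainder

variable {R : ℝ → ℝ} {σ₀ δ : ℝ}

theorem locallyIntegrableOn_truncate (hR : ContinuousOn R (Ioi 0)) :
    LocallyIntegrableOn (truncate R δ) (Ioi 0) := by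
  have h : LocallyIntegrableOn (fun t => (R t : ℂ)) (Ioi 0) :=
    (continuous_ofReal.comp_continuousOn hR).locallyIntegrableOn measurableSet_Ioi
  intro x hx
  obtain ⟨u, hu, hi⟩ := h x hx
  exact ⟨u, hu, hi.indicator measurableSet_Ioc⟩

/-- The truncation vanishes beyond `δ`, so `a` is free and convergence has no upper limit on `Re s`.
-/
theorem truncate_isBigO_atTop (a : ℝ) : truncate R δ =O[atTop] fun t : ℝ => t ^ (-a) := by
  refine EventuallyEq.trans_isBigO ?_ (isBigO_zero _ _)
  filter_upwards [eventually_gt_atTop δ] with t ht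
  exact indicator_of_notMem (fun h => ht.not_ge h.2) _

theorem truncate_isBigO_zero (hRO : R =O[𝓝[>] 0] fun t : ℝ => t ^ (-σ₀)) :
    truncate R δ =O[𝓝[>] 0] fun t : ℝ => t ^ (-σ₀) := by
  refine IsBigO.trans (IsBigO.of_bound 1 (Eventually.of_forall fun t => ?_)) hRO
  rw [one_mul, truncate]
  exact (norm_indicator_le_norm_self _ _).trans (by simp)

theorem mellinConvergent_truncate (hR : ContinuousOn R (Ioi 0))
    (hRO : R =O[𝓝[>] 0] fun t : ℝ => t ^ (-σ₀)) {s : ℂ} (hs : σ₀ < s.re) :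
    MellinConvergent (truncate R δ) s :=
  mellinConvergent_of_isBigO_rpow (locallyIntegrableOn_truncate hR)
    (truncate_isBigO_atTop (s.re + 1)) (lt_add_one _) (truncate_isBigO_zero hRO) hs

theorem differentiableOn_remainderZeta (hR : ContinuousOn R (Ioi 0))
    (hRO : R =O[𝓝[>] 0] fun t : ℝ => t ^ (-σ₀)) :
    DifferentiableOn ℂ (remainderZeta R δ) (halfPlane σ₀) := fun s hs =>
  (mellin_differentiableAt_of_isBigO_rpow (locallyIntegrableOn_truncate hR)
    (truncate_isBigO_atTop (s.re + 1)) (lt_add_one _) (truncate_isBigO_zero hRO)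
    (EReal.coe_lt_coe_iff.1 hs)).differentiableWithinAt

theorem isOpen_halfPlane (σ : EReal) : IsOpen (halfPlane σ) :=
  isOpen_lt continuous_const (continuous_coe_real_ereal.comp continuous_re)

theorem isContinuation_remainderZeta (hR : ContinuousOn R (Ioi 0))
    (hRO : R =O[𝓝[>] 0] fun t : ℝ => t ^ (-σ₀)) {D : ℝ} (hD : σ₀ ≤ D) :
    IsContinuation (remainderZeta R δ) D (halfPlane σ₀) (remainderZeta R δ) ∅ where
  isOpen := isOpen_halfPlane _
  holomorphic := (differentiableOn_remainderZeta hR hRO).mono fun _ hs =>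
    (EReal.coe_le_coe_iff.2 hD).trans_lt hs
  eqOn _ _ := rfl
  discrete z _ := by simp [AccPt]
  differentiableOn := by simpa using differentiableOn_remainderZeta hR hRO

/-- A Mellin transform is bounded in closed vertical strips in which it converges absolutely. -/
theorem exists_norm_mellin_le {f : ℝ → ℂ} {a β : ℝ} (ha : MellinConvergent f a)
    (hβ : MellinConvergent f β) :
    ∃ C > 0, ∀ s : ℂ, s.re ∈ Icc a β → ‖mellin f s‖ ≤ C := by
  have hi := ha.norm.add hβ.norm
  refine ⟨(∫ t in Ioi (0 : ℝ), ‖(t : ℂ) ^ ((a : ℂ) - 1) • f t‖ +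
    ‖(t : ℂ) ^ ((β : ℂ) - 1) • f t‖) + 1, ?_, fun s hs => ?_⟩
  · have : 0 ≤ ∫ t in Ioi (0 : ℝ), ‖(t : ℂ) ^ ((a : ℂ) - 1) • f t‖ +
      ‖(t : ℂ) ^ ((β : ℂ) - 1) • f t‖ := integral_nonneg fun t => by positivity
    linarith
  · refine le_trans ?_ (le_add_of_nonneg_right zero_le_one)
    refine norm_integral_le_of_norm_le hi ?_
    filter_upwards [ae_restrict_mem measurableSet_Ioi] with t ht
    have ht : 0 < t := ht
    simp only [norm_smul, norm_cpow_eq_rpow_re_of_pos ht, sub_re, ofReal_re, one_re, ← add_mul]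
    refine mul_le_mul_of_nonneg_right ?_ (norm_nonneg _)
    have h1 := Real.rpow_nonneg ht.le (a - 1)
    have h2 := Real.rpow_nonneg ht.le (β - 1)
    -- In the strip, `t ^ (Re s - 1)` is at most its value at the left edge if `t ≤ 1`, and at the
    -- right edge if `t ≥ 1`; the sum dominates both.
    rcases le_total t 1 with h | h
    · have := Real.rpow_le_rpow_of_exponent_ge ht h (sub_le_sub_right hs.1 1)
      linarith
    · have := Real.rpow_le_rpow_of_exponent_le h (sub_le_sub_right hs.2 1)
      linarith

end Remainder

/-! ### Admissibility of constant screens -/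

theorem isScreen_const (a : ℝ) : IsScreen fun _ => a :=
  ⟨⟨|a|, fun _ => le_rfl⟩, 0, LipschitzWith.const a⟩

theorem halfPlane_subset_window_const {a D : ℝ} (h : a ≤ D) :
    halfPlane D ⊆ window fun _ => a := fun _ hs =>
  h.trans (EReal.coe_lt_coe_iff.1 hs).le

theorem SelfSimilarSystem.isAdmissibleScreen_const {X : Type*} [MetricSpace X]
    (Φ : SelfSimilarSystem X) {R : ℝ → ℝ} (hR : ContinuousOn R (Ioi 0)) {σ₀ : ℝ}
    (hRO : R =O[𝓝[>] 0] fun t : ℝ => t ^ (-σ₀)) (δ : ℝ) {a : ℝ} (ha : σ₀ < a)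
    (ha' : a < Φ.lowerSimDim) :
    IsAdmissibleScreen Φ.scalingOperator R δ (fun _ => a) := by
  -- Beyond `D` the denominator has no zeros, and `a ≤ D` puts that half-plane in the window. The
  -- abscissa `β > D` of L1 is `D + 1`.
  obtain ⟨D, hD, haD⟩ := (Φ.eventually_zetaDenom_ne_zero.and (eventually_ge_atTop a)).exists
  obtain ⟨c, hc, hca⟩ := Φ.exists_pos_le_norm_zetaDenom ha'
  obtain ⟨T, hT, c', hc', hcT⟩ := Φ.exists_admissibleHeights a (D + 1)
  have hmell : ∀ b : ℝ, a ≤ b → MellinConvergent (truncate R δ) b := fun b hb =>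
    mellinConvergent_truncate hR hRO (by simpa using ha.trans_le hb)
  obtain ⟨C, hC, hCb⟩ := exists_norm_mellin_le (hmell a le_rfl) (hmell (D + 1) (by linarith))
  have hwin := halfPlane_subset_window_const haD
  have hζ : IsScreenExtension Φ.scalingOperator.zeta D (fun _ => a) Φ.scalingOperator.zeta
      {s | Φ.zetaDenom s = 0} :=
    ⟨⟨univ, subset_univ _, Φ.isContinuation_zeta hD isOpen_univ⟩, hwin, fun τ h0 => by
      have := hca (screenPoint (fun _ => a) τ) rfl
      rw [show Φ.zetaDenom _ = 0 from h0, norm_zero] at this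
      linarith⟩
  have hρ : IsScreenExtension (remainderZeta R δ) D (fun _ => a) (remainderZeta R δ) ∅ :=
    ⟨⟨halfPlane σ₀, fun s hs => EReal.coe_lt_coe_iff.2 (ha.trans_le hs),
      isContinuation_remainderZeta hR hRO (ha.le.trans haD)⟩, hwin, fun _ => notMem_empty _⟩
  refine ⟨⟨σ₀, fun s hs => mellinConvergent_truncate hR hRO (EReal.coe_lt_coe_iff.1 hs),
    differentiableOn_remainderZeta hR hRO⟩, ?_⟩
  refine ⟨⟨D, (Φ.isContinuation_zeta hD isOpen_univ).holomorphic,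
    (isContinuation_remainderZeta hR hRO (ha.le.trans haD)).holomorphic⟩, isScreen_const a,
    fun τ => ?_, ⟨T, ⟨hT, D, _, _, hζ, c'⁻¹, inv_pos.2 hc', D + 1, lt_add_one D, fun n σ hσ => ?_⟩,
    hT, D, _, _, hρ, C, hC, D + 1, lt_add_one D, fun n σ hσ => ?_⟩,
    ⟨D, _, _, hζ, c⁻¹, inv_pos.2 hc, fun τ _ => ?_⟩, D, _, _, hρ, C, hC, fun τ _ => ?_⟩
  -- Both functions extend to `Re s > σ₀`, so the joint abscissa is at most `σ₀ < a`.
  · have h : jointAbscissa Φ.scalingOperator.zeta (remainderZeta R δ) ≤ σ₀ :=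
      sInf_le ⟨EReal.coe_lt_top σ₀, ⟨D, _, _, Φ.isContinuation_zeta hD (isOpen_halfPlane _)⟩,
        ⟨σ₀, _, _, isContinuation_remainderZeta hR hRO le_rfl⟩⟩
    exact h.trans_lt (EReal.coe_lt_coe_iff.2 ha)
  · have h := hcT n σ hσ
    refine ⟨fun h0 => ?_, by simpa using Φ.norm_zeta_le hc' h⟩
    rw [show Φ.zetaDenom _ = 0 from h0, norm_zero] at h
    linarith
  · exact ⟨notMem_empty _, by simpa [remainderZeta] using hCb ⟨σ, T n⟩ hσ⟩
  · simpa using Φ.norm_zeta_le hc (hca (screenPoint (fun _ => a) τ) rfl)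
  · simpa [remainderZeta] using
      hCb (screenPoint (fun _ => a) τ) ⟨le_rfl, haD.trans (lt_add_one D).le⟩

theorem mainTheorem11 {X : Type*} [MetricSpace X] [CompleteSpace X] (Φ : SelfSimilarSystem X)
    (R : ℝ → ℝ) (hR : ContinuousOn R (Set.Ioi 0)) (σ₀ : ℝ) (hσ₀ : σ₀ < Φ.lowerSimDim)
    (hRO : R =O[𝓝[>] 0] fun t : ℝ => t ^ (-σ₀)) (δ : ℝ) (hδ : 0 < δ) :
    IsAdmissibleRemainder Φ.scalingOperator R δ ∧
      ∀ ε : ℝ, 0 < ε → ε < Φ.lowerSimDim - σ₀ →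
        IsAdmissibleScreen Φ.scalingOperator R δ (fun _ => σ₀ + ε) := by
  obtain ⟨a, ha, ha'⟩ := exists_between hσ₀
  exact ⟨⟨_, Φ.isAdmissibleScreen_const hR hRO δ ha ha'⟩, fun ε hε hε' =>
    Φ.isAdmissibleScreen_const hR hRO δ (by linarith) (by linarith)⟩
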